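/- A state of two qubits is a positive semidefinite $4\times4$ complex matrix $\rho$ of trace one on $\mathbb{C}^2\otimes\mathbb{C}^2$, written in the product basis $|00\rangle,|01\rangle,|10\rangle,|11\rangle$. Its fidelity is $F(\rho)=\max_{\psi}\langle\psi|\rho|\psi\rangle$, where $\psi$ ranges over the maximally entangled states, i.e. the vectors whose reduced state on the first qubit is $\frac12 I$. Its concurrence is $C(\rho)=\max(0,\lambda_1-\lambda_2-\lambda_3-\lambda_4)$, where $\lambda_1\ge\lambda_2\ge\lambda_3\ge\lambda_4$ are the square roots of the eigenvalues of $\rho\,(\sigma_y\otimes\sigma_y)\rho^*(\sigma_y\otimes\sigma_y)$ and $\rho^*$ is the entrywise complex conjugate of $\rho$. Theorem. Every state $\rho$ of two qubits satisfies \[F(\rho)\ \ge\ \max\left(\frac{1+C(\rho)}{4},\,C(\rho)\right),\] and this bound is tight: for every $c\in[0,1]$, the number $\max\left(\frac{1+c}{4},c\right)$ is the least fidelity of a two-qubit state with concurrence $c$. Explicitly: for $0\le c\le\frac13$ the matrix \[\begin{pmatrix}\frac{1+c}{2}&0&0&0\\0&\frac{1-c+\sqrt{1-2c-3c^2}}{4}&-\frac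 c2&0\\0&-\frac c2&\frac{1-c-\sqrt{1-2c-3c^2}}{4}&0\\0&0&0&0\end{pmatrix}\] is a state of rank $2$ with concurrence $c$ and fidelity $\max\left(\frac{1+c}{4},c\right)=\frac{1+c}{4}$; for $\frac13\le c\le1$ the matrix \[\begin{pmatrix}1-c&0&0&0\\0&\frac c2&-\frac c2&0\\0&-\frac c2&\frac c2&0\\0&0&0&0\end{pmatrix}\] is a state with concurrence $c$ and fidelity $\max\left(\frac{1+c}{4},c\right)=c$; it has rank $2$ if $c<1$ and rank $1$ if $c=1$. -/

import Mathlib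

open scoped Matrix Kronecker ComplexOrder

noncomputable section

/-- Operators on the space of two qubits, in the product basis `(0,0), (0,1), (1,0), (1,1)`. -/
abbrev TwoQubitOp : Type := Matrix (Fin 2 × Fin 2) (Fin 2 × Fin 2) ℂ

/-- A (mixed) state of two qubits: a positive semidefinite operator of trace one. -/
def IsTwoQubitState (ρ : TwoQubitOp) : Prop := ρ.PosSemidef ∧ ρ.trace = 1

/-- The reduced state of the first qubit of the vector `ψ`, that is, the partial trace over the
second qubit of `|ψ⟩⟨ψ|`. -/
def reducedState (ψ : Fin 2 × Fin 2 → ℂ) : Matrix (Fin 2) (Fin 2) ℂ :=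
  Matrix.of fun i k => ∑ j, ψ (i, j) * star (ψ (k, j))

/-- `ψ` is a maximally entangled state: its reduced state is the maximally mixed state `1 / 2`
(so `ψ` is in particular a unit vector). -/
def IsMaximallyEntangled (ψ : Fin 2 × Fin 2 → ℂ) : Prop :=
  reducedState ψ = (1 / 2 : ℂ) • (1 : Matrix (Fin 2) (Fin 2) ℂ)

/-- The values `⟨ψ|ρ|ψ⟩`, where `ψ` runs over the maximally entangled states. -/
def maxEntangledOverlaps (ρ : TwoQubitOp) : Set ℝ :=
  {x | ∃ ψ : Fin 2 × Fin 2 → ℂ, IsMaximallyEntangled ψ ∧ x = (star ψ ⬝ᵥ (ρ *ᵥ ψ)).re}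

/-- The fidelity (maximal singlet fraction) of `ρ`: the maximum of `⟨ψ|ρ|ψ⟩` over the maximally
entangled states `ψ`. It is attained, see `isGreatest_fidelity`. -/
def fidelity (ρ : TwoQubitOp) : ℝ := sSup (maxEntangledOverlaps ρ)

theorem isCompact_maximallyEntangled : IsCompact {ψ | IsMaximallyEntangled ψ} := by
  apply Metric.isCompact_of_isClosed_isBounded
  · refine isClosed_eq ?_ continuous_const
    unfold reducedState
    fun_prop
  · rw [isBounded_iff_forall_norm_le]
    refine ⟨1, fun ψ hψ => ?_⟩
    rw [pi_norm_le_iff_of_nonneg zero_le_one]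
    rintro ⟨i, j⟩
    have h := congrArg Complex.re (congrFun (congrFun hψ i) i)
    have h2 : ∑ j, ‖ψ (i, j)‖ ^ 2 = 1 / 2 := by
      simpa [reducedState, Complex.mul_conj, Complex.normSq_eq_norm_sq,
        ← Complex.ofReal_pow] using h
    have h3 := Finset.single_le_sum (f := fun j => ‖ψ (i, j)‖ ^ 2)
      (fun j _ => sq_nonneg _) (Finset.mem_univ j)
    simp only [h2] at h3
    nlinarith [norm_nonneg (ψ (i, j))]

theorem exists_maximallyEntangled : ∃ ψ, IsMaximallyEntangled ψ := by
  refine ⟨fun p => if p.1 = p.2 then ((√2 : ℝ) : ℂ)⁻¹ else 0, ?_⟩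
  have h : ((√2 : ℝ) : ℂ)⁻¹ * ((√2 : ℝ) : ℂ)⁻¹ = 2⁻¹ := by
    rw [← mul_inv, ← Complex.ofReal_mul, Real.mul_self_sqrt (by norm_num)]
    norm_num
  unfold IsMaximallyEntangled reducedState
  ext i k
  fin_cases i <;> fin_cases k <;> simp [h]

/-- The supremum in the definition of the fidelity is a maximum. -/
theorem isGreatest_fidelity (ρ : TwoQubitOp) :
    IsGreatest (maxEntangledOverlaps ρ) (fidelity ρ) := by
  have e : maxEntangledOverlaps ρ =
      (fun ψ : Fin 2 × Fin 2 → ℂ => (star ψ ⬝ᵥ (ρ *ᵥ ψ)).re) '' {ψ | IsMaximallyEntangled ψ} := by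
    ext x
    simp [maxEntangledOverlaps, eq_comm]
  have hc : IsCompact (maxEntangledOverlaps ρ) := by
    rw [e]
    refine isCompact_maximallyEntangled.image ?_
    unfold Matrix.mulVec dotProduct
    fun_prop
  obtain ⟨ψ, hψ⟩ := exists_maximallyEntangled
  exact hc.isGreatest_sSup ⟨_, ψ, hψ, rfl⟩

/-- The Pauli matrix `σ_y`. -/
def pauliY : Matrix (Fin 2) (Fin 2) ℂ := !![0, -Complex.I; Complex.I, 0]

/-- The spin-flipped operator `(σ_y ⊗ σ_y) ρ* (σ_y ⊗ σ_y)`, where `ρ*` is the entrywise complex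
conjugate of `ρ` in the product basis. -/
def spinFlip (ρ : TwoQubitOp) : TwoQubitOp :=
  (pauliY ⊗ₖ pauliY) * ρ.map star * (pauliY ⊗ₖ pauliY)

/-- The square roots of the four eigenvalues of `ρ ρ̃`, with algebraic multiplicity and in
decreasing order, where `ρ̃` is the spin flip of `ρ`. For a state these eigenvalues are
nonnegative reals, because `ρ ρ̃` is a product of two positive semidefinite operators. -/
def woottersList (ρ : TwoQubitOp) : List ℝ :=
  ((ρ * spinFlip ρ).charpoly.roots.map fun z => √z.re).sort (· ≥ ·)

theorem length_woottersList (ρ : TwoQubitOp) : (woottersList ρ).length = 4 := by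
  simp [woottersList, IsAlgClosed.card_roots_eq_natDegree, Matrix.charpoly_natDegree_eq_dim]

/-- The (Wootters) concurrence `max (0, λ₁ - λ₂ - λ₃ - λ₄)`, where `λ₁ ≥ λ₂ ≥ λ₃ ≥ λ₄` are the
square roots of the eigenvalues of `ρ ρ̃`. -/
def concurrence (ρ : TwoQubitOp) : ℝ :=
  max 0 ((woottersList ρ).getD 0 0 - (woottersList ρ).getD 1 0
    - (woottersList ρ).getD 2 0 - (woottersList ρ).getD 3 0)

/-- The operator on two qubits with a given real `4 × 4` matrix in the product basis, ordered
`(0,0), (0,1), (1,0), (1,1)`. -/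
def ofProductBasis (A : Matrix (Fin 4) (Fin 4) ℝ) : TwoQubitOp :=
  (A.map Complex.ofReal).submatrix finProdFinEquiv finProdFinEquiv

/-- The minimizing family for `0 ≤ c ≤ 1 / 3`. -/
def lowState (c : ℝ) : TwoQubitOp :=
  ofProductBasis
    !![(1 + c) / 2, 0, 0, 0;
       0, (1 - c + √(1 - 2 * c - 3 * c ^ 2)) / 4, -c / 2, 0;
       0, -c / 2, (1 - c - √(1 - 2 * c - 3 * c ^ 2)) / 4, 0;
       0, 0, 0, 0]

/-- The minimizing family for `1 / 3 ≤ c ≤ 1`. -/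
def highState (c : ℝ) : TwoQubitOp :=
  ofProductBasis
    !![1 - c, 0, 0, 0;
       0, c / 2, -c / 2, 0;
       0, -c / 2, c / 2, 0;
       0, 0, 0, 0]

end

/-!
In the magic basis the spin flip is entrywise complex conjugation and the real unit vectors are
maximally entangled. With `R` the matrix of `ρ` in this basis, the fidelity `f` is therefore an
upper bound of the real symmetric matrix `Re R`, and the Wootters numbers are the square roots `λᵢ`
of the eigenvalues of `R * Rᵀ`. The lower bound on the fidelity says that `λᵢ ≤ f` and
`tr R + 2 λᵢ - ∑ⱼ λⱼ ≤ 4 f` for each `i` (`Matrix.PosSemidef.exists_spectrum_mul_transpose`); no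
ordering of the `λᵢ` is needed.

For positive definite `R` write `R = E * L * E` with `E` positive definite, `E * Eᵀ = 1`, and `L`
real: `E * E` is the geometric mean of `R` and the inverse of `Rᵀ`
(`Matrix.PosDef.exists_orthogonal_mul_symmetric_mul`). Then `R * Rᵀ` is similar to `L * L`, so the
`λᵢ` are the eigenvalues of `L`. With `E = P + i N`, where `P` is symmetric, `N` antisymmetric and
`P * P + N * N = 1`, one gets `Re R = P * L * P - N * L * N` and `tr R = tr L - 2 tr (N * N * L)`,
and the second inequality becomes `λᵢ - tr (N * N * L) ≤ 2 f` (`eigenvalue_sub_trace_le`). In the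
normal form of `N` with two `2 × 2` blocks, `P` is scalar on each block, and testing `Re R ≤ f` on
the two normalized block components of an eigenvector of `L` gives exactly this. Singular `R` are
reached as limits of `R + ε`.

The minimizing states are `B * Bᴴ` for a `4 × 2` matrix `B` with orthogonal columns, which gives
positivity and the rank. Their `R * Rᵀ` has characteristic polynomial `X ^ 3 * (X - c ^ 2)`, so the
concurrence is `c`, and the fidelity is bounded above through the equations of a maximally
entangled vector.
-/

/-! ### The geometric mean of a positive definite matrix and its inverse transpose -/

section GeometricMean
open scoped MatrixOrder
variable {n : Type*} [Fintype n] [DecidableEq n]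

namespace Matrix

theorem PosSemidef.eq_of_mul_self_eq {𝕜 : Type*} [RCLike 𝕜] {A B : Matrix n n 𝕜} (hA : A.PosSemidef)
    (hB : B.PosSemidef) (h : A * A = B * B) : A = B := by
  rw [← CFC.sqrt_unique h hA.nonneg, CFC.sqrt_unique rfl hB.nonneg]

theorem PosDef.exists_posDef_mul_self {A : Matrix n n ℂ} (hA : A.PosDef) :
    ∃ S : Matrix n n ℂ, S.PosDef ∧ S * S = A := by
  refine ⟨CFC.sqrt A, ?_, CFC.sqrt_mul_sqrt_self A hA.posSemidef.nonneg⟩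
  refine (nonneg_iff_posSemidef.1 (CFC.sqrt_nonneg A)).posDef_iff_isUnit.2 ?_
  refine isUnit_of_mul_isUnit_left (y := CFC.sqrt A) ?_
  rw [CFC.sqrt_mul_sqrt_self A hA.posSemidef.nonneg]
  exact hA.isUnit

theorem PosDef.mul_mul_self {A B : Matrix n n ℂ} (hA : A.PosDef) (hB : B.PosDef) :
    (A * B * A).PosDef := by
  have h := (IsUnit.posDef_star_left_conjugate_iff (x := B) hA.isUnit).2 hB
  rwa [star_eq_conjTranspose, hA.isHermitian.eq] at h

/-- The Riccati equation `M * A * M = B` has at most one positive definite solution `M`: after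
conjugation by the square root of `A` it says what the square of a positive definite matrix is. -/
theorem PosDef.eq_of_mul_mul_eq {A M M' : Matrix n n ℂ} (hA : A.PosDef) (hM : M.PosDef)
    (hM' : M'.PosDef) (h : M * A * M = M' * A * M') : M = M' := by
  obtain ⟨K, hK, rfl⟩ := hA.exists_posDef_mul_self
  have h1 : K * M * K = K * M' * K := by
    refine (hK.mul_mul_self hM).posSemidef.eq_of_mul_self_eq (hK.mul_mul_self hM').posSemidef ?_
    calc K * M * K * (K * M * K) = K * (M * (K * K) * M) * K := by simp only [mul_assoc]
      _ = K * M' * K * (K * M' * K) := by rw [h]; simp only [mul_assoc]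
  exact hK.isUnit.mul_left_cancel (hK.isUnit.mul_right_cancel h1)

/-- The Riccati equation `M * B * M = A` has a positive definite solution, the geometric mean of
`A` and `B⁻¹`. -/
theorem PosDef.exists_posDef_mul_mul_eq {A B : Matrix n n ℂ} (hA : A.PosDef) (hB : B.PosDef) :
    ∃ M : Matrix n n ℂ, M.PosDef ∧ M * B * M = A := by
  obtain ⟨S, hS, rfl⟩ := hA.exists_posDef_mul_self
  obtain ⟨H, hH, hG⟩ := (hS.mul_mul_self hB).exists_posDef_mul_self
  refine ⟨S * H⁻¹ * S, hS.mul_mul_self hH.inv, ?_⟩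
  have hd : IsUnit H.det := (isUnit_iff_isUnit_det H).1 hH.isUnit
  calc S * H⁻¹ * S * B * (S * H⁻¹ * S) = S * H⁻¹ * (S * B * S) * H⁻¹ * S := by
        simp only [mul_assoc]
    _ = S * (H⁻¹ * H) * (H * H⁻¹) * S := by rw [← hG]; simp only [mul_assoc]
    _ = S * S := by rw [nonsing_inv_mul _ hd, mul_nonsing_inv _ hd, mul_one, mul_one]

/-- A positive definite `R` is `E * L * E` with `E` positive definite and complex orthogonal, and
`L` real (Hermitian and symmetric). Here `E` is the square root of the geometric mean `M` of `R`
and `Rᵀ⁻¹`. Both `M` and `Mᵀ⁻¹` solve `M * Rᵀ * M = R`, so `M` is orthogonal, and `E` inherits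
this from the uniqueness of square roots. -/
theorem PosDef.exists_orthogonal_mul_symmetric_mul {R : Matrix n n ℂ} (hR : R.PosDef) :
    ∃ E L : Matrix n n ℂ, E.PosDef ∧ E * Eᵀ = 1 ∧ L.PosDef ∧ Lᵀ = L ∧ R = E * L * E := by
  obtain ⟨M, hM, hMR⟩ := hR.exists_posDef_mul_mul_eq hR.transpose
  have hMd : IsUnit M.det := (isUnit_iff_isUnit_det M).1 hM.isUnit
  -- `Mᵀ` and `M⁻¹` both solve `X * R * X = Rᵀ`.
  have hMT : Mᵀ = M⁻¹ := by
    refine hR.eq_of_mul_mul_eq hM.transpose hM.inv ?_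
    have h1 : Mᵀ * R * Mᵀ = Rᵀ := by
      conv_rhs => rw [← hMR]
      simp [mul_assoc]
    rw [h1]
    conv_rhs => rw [← hMR]
    calc Rᵀ = (M⁻¹ * M) * Rᵀ * (M * M⁻¹) := by
          rw [nonsing_inv_mul _ hMd, mul_nonsing_inv _ hMd, mul_one, one_mul]
      _ = _ := by simp only [mul_assoc]
  obtain ⟨E, hE, rfl⟩ := hM.exists_posDef_mul_self
  have hEd : IsUnit E.det := (isUnit_iff_isUnit_det E).1 hE.isUnit
  have hET : Eᵀ = E⁻¹ := by
    refine hE.transpose.posSemidef.eq_of_mul_self_eq hE.inv.posSemidef ?_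
    rw [← transpose_mul, hMT, mul_inv_rev]
  have hEinv : E⁻¹ᵀ = E := by rw [← hET, transpose_transpose]
  refine ⟨E, E⁻¹ * R * E⁻¹, hE, ?_, hE.inv.mul_mul_self hR, ?_, ?_⟩
  · rw [hET, mul_nonsing_inv _ hEd]
  · conv_rhs => rw [← hMR]
    calc (E⁻¹ * R * E⁻¹)ᵀ = E * Rᵀ * E := by
          simp only [transpose_mul, hEinv, mul_assoc]
      _ = (E⁻¹ * E) * E * Rᵀ * E * (E * E⁻¹) := by
          rw [nonsing_inv_mul _ hEd, mul_nonsing_inv _ hEd, mul_one, one_mul]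
      _ = _ := by simp only [mul_assoc]
  · calc R = (E * E⁻¹) * R * (E⁻¹ * E) := by
          rw [nonsing_inv_mul _ hEd, mul_nonsing_inv _ hEd, mul_one, one_mul]
      _ = _ := by simp only [mul_assoc]

end Matrix
end GeometricMean

/-! ### Real antisymmetric `4 × 4` matrices and the eigenvalue bounds -/

section RealNormalForm
open Matrix

/-- The real antisymmetric matrix with the two diagonal blocks `!![0, -n; n, 0]` and
`!![0, -m; m, 0]`: the normal form of antisymmetric matrices under real orthogonal conjugation. -/
def skewBlocks (n m : ℝ) : Matrix (Fin 4) (Fin 4) ℝ :=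
  !![0, -n, 0, 0; n, 0, 0, 0; 0, 0, 0, -m; 0, 0, m, 0]

/-- An eigenvector of `Nᵀ * N` with nonzero eigenvalue and its normalized image under `N` span an
invariant plane of the antisymmetric matrix `N`. -/
theorem exists_unit_pair_of_skew {N : Matrix (Fin 4) (Fin 4) ℝ} (hN : Nᵀ = -N) (h0 : N ≠ 0) :
    ∃ (n : ℝ) (e f : Fin 4 → ℝ), e ⬝ᵥ e = 1 ∧ f ⬝ᵥ f = 1 ∧ e ⬝ᵥ f = 0 ∧
      N *ᵥ e = n • f ∧ N *ᵥ f = -n • e := by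
  have hS : (Nᵀ * N).IsHermitian := by
    simpa using isHermitian_conjTranspose_mul_self N
  obtain ⟨i, hi⟩ : ∃ i, hS.eigenvalues i ≠ 0 := by
    by_contra! h
    have h1 : Nᵀ * N = 0 := hS.eigenvalues_eq_zero_iff.1 (funext h)
    exact h0 (conjTranspose_mul_self_eq_zero.1 (by simpa using h1))
  set μ := hS.eigenvalues i
  set e : Fin 4 → ℝ := (hS.eigenvectorBasis i).ofLp
  have he : e ⬝ᵥ e = 1 := by
    have := hS.eigenvectorBasis.inner_eq_one i
    rwa [EuclideanSpace.inner_eq_star_dotProduct, star_trivial] at this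
  have hNe : (Nᵀ * N) *ᵥ e = μ • e := hS.mulVec_eigenvectorBasis i
  have hμ : (N *ᵥ e) ⬝ᵥ (N *ᵥ e) = μ := by
    have h := congrArg (fun w => e ⬝ᵥ w) hNe
    simp only [dotProduct_smul, he, smul_eq_mul, mul_one] at h
    rw [← h, ← mulVec_mulVec, dotProduct_mulVec e, vecMul_transpose]
  have hμ0 : 0 ≤ μ := by
    rw [← hμ]
    exact Finset.sum_nonneg fun j _ => mul_self_nonneg _
  have hs : √μ ≠ 0 := by
    rw [Real.sqrt_ne_zero hμ0]
    exact hi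
  have hss : √μ * √μ = μ := Real.mul_self_sqrt hμ0
  refine ⟨√μ, e, (√μ)⁻¹ • N *ᵥ e, he, ?_, ?_, ?_, ?_⟩
  · simp only [dotProduct_smul, smul_dotProduct, hμ, smul_eq_mul]
    field_simp
    rw [pow_two, hss]
  · have h : e ⬝ᵥ N *ᵥ e = -(e ⬝ᵥ N *ᵥ e) := by
      conv_lhs => rw [dotProduct_mulVec, ← mulVec_transpose, hN, neg_mulVec, neg_dotProduct,
        dotProduct_comm]
    rw [dotProduct_smul, self_eq_neg.1 h, smul_zero]
  · rw [smul_smul, mul_inv_cancel₀ hs, one_smul]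
  · have h : N *ᵥ N *ᵥ e = -(μ • e) := by
      rw [← hNe, hN, neg_mul, neg_mulVec, neg_neg, mulVec_mulVec]
    rw [mulVec_smul, h, ← smul_neg, smul_neg, smul_neg, smul_smul, neg_smul]
    congr 2
    rw [inv_mul_eq_iff_eq_mul₀ hs, hss]

theorem exists_orthogonal_skewBlocks {N : Matrix (Fin 4) (Fin 4) ℝ} (hN : Nᵀ = -N) :
    ∃ (Q : Matrix (Fin 4) (Fin 4) ℝ) (n m : ℝ), Qᵀ * Q = 1 ∧ Qᵀ * N * Q = skewBlocks n m := by
  by_cases h0 : N = 0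
  · refine ⟨1, 0, 0, by simp, ?_⟩
    ext i j
    fin_cases i <;> fin_cases j <;> simp [h0, skewBlocks]
  obtain ⟨n, e, f, he, hf, hef, hNe, hNf⟩ := exists_unit_pair_of_skew hN h0
  -- The invariant plane of `e` and `f` is completed to an orthonormal basis; its orthogonal
  -- complement is a plane, where an antisymmetric matrix has the required form.
  obtain ⟨b, hb⟩ := Orthonormal.exists_orthonormalBasis_extension_of_card_eq
    (𝕜 := ℝ) (E := EuclideanSpace ℝ (Fin 4)) (ι := Fin 4) (by simp)
    (v := fun i => if i = 0 then WithLp.toLp 2 e else WithLp.toLp 2 f) (s := {0, 1}) (by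
      rw [orthonormal_iff_ite]
      have hfe : f ⬝ᵥ e = 0 := by rw [dotProduct_comm, hef]
      rintro ⟨i, rfl | rfl⟩ ⟨j, rfl | rfl⟩ <;>
        simp [-inner_self_eq_norm_sq_to_K, EuclideanSpace.inner_toLp_toLp, he, hf, hef, hfe,
          Subtype.ext_iff])
  have hb0 : (b 0).ofLp = e := by rw [hb 0 (by simp)]; rfl
  have hb1 : (b 1).ofLp = f := by rw [hb 1 (by simp)]; rfl
  have hbb : ∀ i j, (b i).ofLp ⬝ᵥ (b j).ofLp = if i = j then 1 else 0 := by
    intro i j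
    rw [← orthonormal_iff_ite.1 b.orthonormal i j]
    simp [PiLp.inner_apply, dotProduct, mul_comm]
  let Q : Matrix (Fin 4) (Fin 4) ℝ := of fun i j => b j i
  have hQ : ∀ A : Matrix (Fin 4) (Fin 4) ℝ, ∀ i j,
      (Qᵀ * A * Q) i j = (b i).ofLp ⬝ᵥ A *ᵥ (b j).ofLp := by
    intro A i j
    rw [Matrix.mul_assoc]
    simp [Q, mul_apply, dotProduct, mulVec]
  have hskew : ∀ i j, (Qᵀ * N * Q) i j = -(Qᵀ * N * Q) j i := by
    have h : (Qᵀ * N * Q)ᵀ = -(Qᵀ * N * Q) := by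
      rw [transpose_mul, transpose_mul, transpose_transpose, hN, Matrix.mul_assoc]
      simp only [Matrix.neg_mul, Matrix.mul_neg]
    exact fun i j => congrFun (congrFun h j) i
  have h0 : ∀ i, (Qᵀ * N * Q) i 0 = if i = 1 then n else 0 := by
    intro i
    rw [hQ, hb0, hNe, ← hb1, dotProduct_smul, hbb]
    simp
  have h1 : ∀ i, (Qᵀ * N * Q) i 1 = if i = 0 then -n else 0 := by
    intro i
    rw [hQ, hb1, hNf, ← hb0, dotProduct_smul, hbb]
    simp
  refine ⟨Q, n, (Qᵀ * N * Q) 3 2, ?_, ?_⟩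
  · ext i j
    have := hQ 1 i j
    rw [Matrix.mul_one, one_mulVec, hbb] at this
    rw [this, one_apply]
  · have hd : ∀ i, (Qᵀ * N * Q) i i = 0 := fun i => self_eq_neg.1 (hskew i i)
    have h32 := hskew 2 3
    have h0' : ∀ i, (Qᵀ * N * Q) 0 i = -if i = 1 then n else 0 := fun i => by rw [hskew, h0]
    have h1' : ∀ i, (Qᵀ * N * Q) 1 i = -if i = 0 then -n else 0 := fun i => by rw [hskew, h1]
    generalize Qᵀ * N * Q = K at *
    ext i j
    fin_cases i <;> fin_cases j <;> simp [skewBlocks, h0, h1, h0', h1', hd, h32]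

/-- Polar coordinates in the plane, with some unit vector chosen at the origin. -/
theorem exists_polar_two (x y : ℝ) : ∃ r a b : ℝ, x = r * a ∧ y = r * b ∧ a ^ 2 + b ^ 2 = 1 := by
  by_cases h : x ^ 2 + y ^ 2 = 0
  · have hx : x = 0 := by nlinarith [sq_nonneg x, sq_nonneg y]
    have hy : y = 0 := by nlinarith [sq_nonneg x, sq_nonneg y]
    exact ⟨0, 1, 0, by simp [hx], by simp [hy], by norm_num⟩
  · have hp : 0 < x ^ 2 + y ^ 2 := lt_of_le_of_ne (by positivity) (Ne.symm h)
    have hs : √(x ^ 2 + y ^ 2) ≠ 0 := (Real.sqrt_pos.2 hp).ne'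
    refine ⟨√(x ^ 2 + y ^ 2), x / √(x ^ 2 + y ^ 2), y / √(x ^ 2 + y ^ 2), ?_, ?_, ?_⟩
    · field_simp
    · field_simp
    · rw [div_pow, div_pow, Real.sq_sqrt hp.le, ← add_div, div_self h]

theorem mulVec_dotProduct_eq {ι κ : Type*} [Fintype ι] [Fintype κ] (A : Matrix ι κ ℝ) (u : κ → ℝ)
    (w : ι → ℝ) : A *ᵥ u ⬝ᵥ w = u ⬝ᵥ Aᵀ *ᵥ w := by
  rw [dotProduct_mulVec, vecMul_transpose]

theorem dotProduct_sandwich_sub_mulVec {ι : Type*} [Fintype ι] {P N : Matrix ι ι ℝ} (hP : Pᵀ = P)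
    (hN : Nᵀ = -N) (L : Matrix ι ι ℝ) (w : ι → ℝ) :
    w ⬝ᵥ ((P * L * P - N * L * N) *ᵥ w) =
      (P *ᵥ w) ⬝ᵥ L *ᵥ (P *ᵥ w) + (N *ᵥ w) ⬝ᵥ L *ᵥ (N *ᵥ w) := by
  have h : P * L * P - N * L * N = Pᵀ * (L * P) + Nᵀ * (L * N) := by
    rw [hP, hN, Matrix.neg_mul, Matrix.mul_assoc, Matrix.mul_assoc, sub_eq_add_neg]
  rw [h, add_mulVec, dotProduct_add]
  simp only [← mulVec_mulVec, dotProduct_mulVec w, vecMul_transpose]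

/-- The core estimate in normal form. The unit vectors `(a, b, 0, 0)` and `(0, 0, c, d)` along the
two block components of `v` are inserted into the hypothesis. The parts of `P * L * P` beyond `L`
and of `-N * L * N` then add up to `-tr (N * N * L)`, whatever the directions in the blocks. What
remains are the diagonal entries of the compression of `L ≥ 0` to the plane of the two vectors;
since this plane contains `v`, their sum is at least `⟨v, L v⟩`. -/
theorem eigenvalue_sub_trace_le_of_blocks {n m p q f lam : ℝ} {L : Matrix (Fin 4) (Fin 4) ℝ}
    (hL : L.PosSemidef) (hp : p ^ 2 = 1 + n ^ 2) (hq : q ^ 2 = 1 + m ^ 2)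
    (hf : ∀ w : Fin 4 → ℝ, w ⬝ᵥ ((diagonal ![p, p, q, q] * L * diagonal ![p, p, q, q]
      - skewBlocks n m * L * skewBlocks n m) *ᵥ w) ≤ f * (w ⬝ᵥ w))
    {v : Fin 4 → ℝ} (hv : v ⬝ᵥ v = 1) (hvL : v ⬝ᵥ L *ᵥ v = lam) :
    lam - (skewBlocks n m * skewBlocks n m * L).trace ≤ 2 * f := by
  obtain ⟨r, a, b, h0, h1, hab⟩ := exists_polar_two (v 0) (v 1)
  obtain ⟨s, c, d, h2, h3, hcd⟩ := exists_polar_two (v 2) (v 3)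
  have hsym : ∀ i j, L i j = L j i := fun i j => by simpa using hL.isHermitian.apply j i
  have hN : (skewBlocks n m)ᵀ = -skewBlocks n m := by
    ext i j
    fin_cases i <;> fin_cases j <;> simp [skewBlocks]
  simp only [dotProduct_sandwich_sub_mulVec (diagonal_transpose _) hN] at hf
  have hN1 : skewBlocks n m *ᵥ ![a, b, 0, 0] = ![-(n * b), n * a, 0, 0] := by
    ext i
    fin_cases i <;> simp [skewBlocks, mulVec, dotProduct, Fin.sum_univ_four]
  have hN2 : skewBlocks n m *ᵥ ![0, 0, c, d] = ![0, 0, -(m * d), m * c] := by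
    ext i
    fin_cases i <;> simp [skewBlocks, mulVec, dotProduct, Fin.sum_univ_four]
  have hP1 : diagonal ![p, p, q, q] *ᵥ ![a, b, 0, 0] = ![p * a, p * b, 0, 0] := by
    ext i
    fin_cases i <;> simp [mulVec_diagonal]
  have hP2 : diagonal ![p, p, q, q] *ᵥ ![0, 0, c, d] = ![0, 0, q * c, q * d] := by
    ext i
    fin_cases i <;> simp [mulVec_diagonal]
  have hNN : skewBlocks n m * skewBlocks n m =
      diagonal ![-n ^ 2, -n ^ 2, -m ^ 2, -m ^ 2] := by
    ext i j
    fin_cases i <;> fin_cases j <;> simp [skewBlocks, mul_apply, Fin.sum_univ_four] <;> ring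
  -- The third vector is the one orthogonal to `v` in the plane of the first two.
  have f1 := hf ![a, b, 0, 0]
  have f2 := hf ![0, 0, c, d]
  have f3 := hL.dotProduct_mulVec_nonneg ![s * a, s * b, -(r * c), -(r * d)]
  rw [hN1, hP1] at f1
  rw [hN2, hP2] at f2
  simp only [dotProduct, mulVec, Fin.sum_univ_four, h0, h1, h2, h3] at hv hvL
  simp only [dotProduct, mulVec, Fin.sum_univ_four, star_trivial, cons_val] at f1 f2 f3
  simp only [hNN, trace, diag, diagonal_mul, Fin.sum_univ_four, cons_val]
  rw [hsym 1 0, hsym 2 0, hsym 3 0, hsym 2 1, hsym 3 1, hsym 3 2] at *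
  have hrs : r ^ 2 + s ^ 2 = 1 := by linear_combination hv - r ^ 2 * hab - s ^ 2 * hcd
  set A := a ^ 2 * L 0 0 + 2 * a * b * L 0 1 + b ^ 2 * L 1 1 with hA
  set B := c ^ 2 * L 2 2 + 2 * c * d * L 2 3 + d ^ 2 * L 3 3 with hB
  have g1 : A + n ^ 2 * (L 0 0 + L 1 1) ≤ f := by
    refine le_of_eq_of_le ?_ (f1.trans_eq (by linear_combination f * hab))
    linear_combination (-A) * hp - n ^ 2 * (L 0 0 + L 1 1) * hab
  have g2 : B + m ^ 2 * (L 2 2 + L 3 3) ≤ f := by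
    refine le_of_eq_of_le ?_ (f2.trans_eq (by linear_combination f * hcd))
    linear_combination (-B) * hq - m ^ 2 * (L 2 2 + L 3 3) * hcd
  -- The trace of the compression of `L` does not depend on the orthonormal basis of the plane.
  have g3 : lam ≤ A + B := by
    refine le_of_sub_nonneg (f3.trans_eq ?_)
    linear_combination (A + B) * hrs - hvL
  linarith

/-- If `P * L * P - N * L * N ≤ f` as a quadratic form, then `lam - tr (N * N * L) ≤ 2 * f` for
every value `lam` that `L` takes on a unit vector: real orthogonal conjugation brings `N` into
block form, and `P`, the positive square root of `1 - N * N`, becomes diagonal. -/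
theorem eigenvalue_sub_trace_le {P N L : Matrix (Fin 4) (Fin 4) ℝ} {f lam : ℝ}
    (hP : P.PosSemidef) (hN : Nᵀ = -N) (hPN : P * P + N * N = 1) (hL : L.PosSemidef)
    (hf : ∀ w : Fin 4 → ℝ, w ⬝ᵥ ((P * L * P - N * L * N) *ᵥ w) ≤ f * (w ⬝ᵥ w))
    {v : Fin 4 → ℝ} (hv : v ⬝ᵥ v = 1) (hvL : v ⬝ᵥ L *ᵥ v = lam) :
    lam - (N * N * L).trace ≤ 2 * f := by
  obtain ⟨Q, n, m, hQ, hQN⟩ := exists_orthogonal_skewBlocks hN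
  have hQ' : Q * Qᵀ = 1 := mul_eq_one_comm.1 hQ
  have hmul : ∀ A B : Matrix (Fin 4) (Fin 4) ℝ, Qᵀ * A * Q * (Qᵀ * B * Q) = Qᵀ * (A * B) * Q := by
    intro A B
    calc Qᵀ * A * Q * (Qᵀ * B * Q) = Qᵀ * A * (Q * Qᵀ) * B * Q := by simp only [Matrix.mul_assoc]
      _ = Qᵀ * (A * B) * Q := by rw [hQ', Matrix.mul_one]; simp only [Matrix.mul_assoc]
  have hPd : Qᵀ * P * Q = diagonal ![√(1 + n ^ 2), √(1 + n ^ 2), √(1 + m ^ 2), √(1 + m ^ 2)] := by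
    refine PosSemidef.eq_of_mul_self_eq (hP.conjTranspose_mul_mul_same Q) ?_ ?_
    · refine posSemidef_diagonal_iff.2 fun i => ?_
      fin_cases i <;> exact Real.sqrt_nonneg _
    · have h1 : P * P = 1 - N * N := eq_sub_of_add_eq hPN
      rw [hmul, h1, Matrix.mul_sub, Matrix.sub_mul, Matrix.mul_one, hQ, ← hmul, hQN]
      have hn : √(1 + n ^ 2) * √(1 + n ^ 2) = 1 + n ^ 2 := Real.mul_self_sqrt (by positivity)
      have hm : √(1 + m ^ 2) * √(1 + m ^ 2) = 1 + m ^ 2 := Real.mul_self_sqrt (by positivity)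
      ext i j
      fin_cases i <;> fin_cases j <;>
        simp [skewBlocks, mul_apply, Fin.sum_univ_four, hn, hm, -Real.mul_self_sqrt] <;> ring
  have key := eigenvalue_sub_trace_le_of_blocks (n := n) (m := m) (p := √(1 + n ^ 2))
    (q := √(1 + m ^ 2)) (f := f) (lam := lam) (L := Qᵀ * L * Q) (v := Qᵀ *ᵥ v)
    (hL.conjTranspose_mul_mul_same Q) (Real.sq_sqrt (by positivity))
    (Real.sq_sqrt (by positivity)) ?_ ?_ ?_
  · rw [← hQN, hmul, hmul, Matrix.mul_assoc, trace_mul_comm, Matrix.mul_assoc, hQ',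
      Matrix.mul_one] at key
    exact key
  · intro w
    rw [← hPd, ← hQN, hmul, hmul, hmul, hmul, ← Matrix.sub_mul, ← Matrix.mul_sub]
    have h := hf (Q *ᵥ w)
    have hw : Q *ᵥ w ⬝ᵥ Q *ᵥ w = w ⬝ᵥ w := by
      rw [mulVec_dotProduct_eq, mulVec_mulVec, hQ, one_mulVec]
    rw [hw, mulVec_dotProduct_eq] at h
    simpa only [mulVec_mulVec, vecMul_transpose, Matrix.mul_assoc] using h
  · rw [mulVec_dotProduct_eq, mulVec_mulVec, transpose_transpose, hQ', one_mulVec, hv]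
  · rw [mulVec_dotProduct_eq, transpose_transpose, mulVec_mulVec, mulVec_mulVec, ← hvL]
    congr 2
    calc Q * (Qᵀ * L * Q) * Qᵀ = (Q * Qᵀ) * L * (Q * Qᵀ) := by simp only [Matrix.mul_assoc]
      _ = L := by rw [hQ', Matrix.one_mul, Matrix.mul_one]

/-- If `P * L * P - N * L * N ≤ f` as a quadratic form, then `L ≤ f`: the vector `w = P⁻¹ v` has
norm at most one, because `P * P = 1 + Nᵀ * N ≥ 1`, and the form is at least `⟨v, L v⟩` on it. -/
theorem eigenvalue_le {ι : Type*} [Fintype ι] [DecidableEq ι] {P N L : Matrix ι ι ℝ} {f lam : ℝ}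
    (hP : Pᵀ = P) (hN : Nᵀ = -N) (hPN : P * P + N * N = 1) (hL : L.PosSemidef)
    (hf : ∀ w : ι → ℝ, w ⬝ᵥ ((P * L * P - N * L * N) *ᵥ w) ≤ f * (w ⬝ᵥ w))
    {v : ι → ℝ} (hv : v ⬝ᵥ v = 1) (hvL : v ⬝ᵥ L *ᵥ v = lam) : lam ≤ f := by
  have hsq : ∀ w : ι → ℝ, P *ᵥ w ⬝ᵥ P *ᵥ w = w ⬝ᵥ w + N *ᵥ w ⬝ᵥ N *ᵥ w := by
    intro w
    have h : Pᵀ * P = 1 + Nᵀ * N := by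
      rw [hP, hN, eq_sub_of_add_eq hPN, Matrix.neg_mul, sub_eq_add_neg]
    rw [mulVec_dotProduct_eq, mulVec_mulVec, h, add_mulVec, dotProduct_add, one_mulVec,
      ← mulVec_mulVec, ← mulVec_dotProduct_eq]
  have hself : ∀ w : ι → ℝ, 0 ≤ w ⬝ᵥ w := fun w =>
    Finset.sum_nonneg fun j _ => mul_self_nonneg _
  have hinj : Function.Injective P.mulVec := by
    refine (injective_iff_map_eq_zero P.mulVecLin).2 fun w hw => ?_
    have h := hsq w
    rw [show P *ᵥ w = 0 from hw, zero_dotProduct] at h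
    exact dotProduct_self_eq_zero.1 (by linarith [hself w, hself (N *ᵥ w)])
  obtain ⟨w, rfl⟩ := mulVec_surjective_iff_isUnit.2 (mulVec_injective_iff_isUnit.1 hinj) v
  have h1 := hf w
  rw [dotProduct_sandwich_sub_mulVec hP hN, hvL] at h1
  have h2 := hL.dotProduct_mulVec_nonneg (N *ᵥ w)
  have h3 := hL.dotProduct_mulVec_nonneg (P *ᵥ w)
  rw [star_trivial] at h2 h3
  have h4 := hsq w
  have hw : w ⬝ᵥ w ≠ 0 := by
    intro h
    simp [dotProduct_self_eq_zero.1 h] at hv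
  have hw0 : 0 < w ⬝ᵥ w := lt_of_le_of_ne (hself w) hw.symm
  have hf0 : 0 ≤ f := nonneg_of_mul_nonneg_left (b := w ⬝ᵥ w) (by linarith) hw0
  nlinarith [hself (N *ᵥ w)]

end RealNormalForm

/-! ### The spectrum of `R * Rᵀ` for positive semidefinite `R` -/

section ComplexCore
open Matrix Polynomial

variable {ι : Type*}

theorem map_re_mul [Fintype ι] (A B : Matrix ι ι ℂ) : (A * B).map Complex.re =
    A.map Complex.re * B.map Complex.re - A.map Complex.im * B.map Complex.im := by
  ext i j
  simp [mul_apply, Complex.re_sum, Finset.sum_sub_distrib]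

theorem map_im_mul [Fintype ι] (A B : Matrix ι ι ℂ) : (A * B).map Complex.im =
    A.map Complex.re * B.map Complex.im + A.map Complex.im * B.map Complex.re := by
  ext i j
  simp [mul_apply, Complex.im_sum, Finset.sum_add_distrib]

theorem dotProduct_map_re_mulVec [Fintype ι] (A : Matrix ι ι ℂ) (w : ι → ℝ) :
    w ⬝ᵥ A.map Complex.re *ᵥ w =
      (star (fun i => (w i : ℂ)) ⬝ᵥ A *ᵥ fun i => (w i : ℂ)).re := by
  simp [dotProduct, mulVec, Complex.re_sum]

theorem Matrix.IsHermitian.transpose_map_re {A : Matrix ι ι ℂ} (hA : A.IsHermitian) :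
    (A.map Complex.re)ᵀ = A.map Complex.re := by
  ext i j
  simpa using congrArg Complex.re (hA.apply i j)

theorem Matrix.IsHermitian.transpose_map_im {A : Matrix ι ι ℂ} (hA : A.IsHermitian) :
    (A.map Complex.im)ᵀ = -A.map Complex.im := by
  ext i j
  simpa [neg_eq_iff_eq_neg] using congrArg Complex.im (hA.apply i j)

theorem Matrix.PosSemidef.map_re [Fintype ι] {A : Matrix ι ι ℂ} (hA : A.PosSemidef) :
    (A.map Complex.re).PosSemidef := by
  refine .of_dotProduct_mulVec_nonneg ?_ fun w => ?_
  · rw [IsHermitian, conjTranspose_eq_transpose_of_trivial, hA.isHermitian.transpose_map_re]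
  · rw [star_trivial, dotProduct_map_re_mulVec]
    exact (Complex.le_def.1 (hA.dotProduct_mulVec_nonneg _)).1

/-- If the real part of the positive definite matrix `R` is at most `f`, then the square roots `μ i`
of the eigenvalues of `R * Rᵀ` satisfy `μ i ≤ f` and `tr R + 2 * μ i - ∑ j, μ j ≤ 4 * f`. With
`R = E * L * E` as in `Matrix.PosDef.exists_orthogonal_mul_symmetric_mul`, they are the eigenvalues
of the real matrix `L`. -/
theorem Matrix.PosDef.exists_spectrum_mul_transpose {R : Matrix (Fin 4) (Fin 4) ℂ} (hR : R.PosDef)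
    {f : ℝ} (hf : ∀ w : Fin 4 → ℝ, w ⬝ᵥ R.map Complex.re *ᵥ w ≤ f * (w ⬝ᵥ w)) :
    ∃ μ : Fin 4 → ℝ, (R * Rᵀ).charpoly = ∏ i, (X - C ((μ i ^ 2 : ℝ) : ℂ)) ∧
      ∀ i, 0 ≤ μ i ∧ μ i ≤ f ∧ R.trace.re + 2 * μ i - ∑ j, μ j ≤ 4 * f := by
  obtain ⟨E, L, hE, hEE, hL, hLT, rfl⟩ := hR.exists_orthogonal_mul_symmetric_mul
  set P := E.map Complex.re with hPdef
  set N := E.map Complex.im with hNdef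
  set K := L.map Complex.re
  have hP : Pᵀ = P := hE.isHermitian.transpose_map_re
  have hN : Nᵀ = -N := hE.isHermitian.transpose_map_im
  have hLim : L.map Complex.im = 0 := by
    have h : L.map Complex.im = -L.map Complex.im := by
      rw [← hL.isHermitian.transpose_map_im, ← transpose_map, hLT]
    ext i j
    exact self_eq_neg.1 (congrFun (congrFun h i) j)
  have hLK : L = K.map (algebraMap ℝ ℂ) := by
    ext i j
    refine Complex.ext rfl ?_
    simpa using congrFun (congrFun hLim i) j
  have hK : K.PosSemidef := hL.posSemidef.map_re
  have hPN : P * P + N * N = 1 := by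
    have h := congrArg (fun A => A.map Complex.re) hEE
    simp only [map_re_mul] at h
    rw [transpose_map, transpose_map, ← hPdef, ← hNdef, hP, hN, Matrix.mul_neg,
      sub_neg_eq_add] at h
    rw [h]
    ext i j
    by_cases hij : i = j <;> simp [hij, one_apply]
  -- `E = P + i N` and `L = K` is real, so this is the real part of `(P + i N) * K * (P + i N)`.
  have hre : (E * L * E).map Complex.re = P * K * P - N * K * N := by
    rw [map_re_mul, map_re_mul, map_im_mul, hLim]
    simp [P, N, K]
  rw [hre] at hf
  have htr : (E * L * E).trace.re = K.trace - 2 * (N * N * K).trace := by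
    have h : (E * L * E).trace.re = ((E * L * E).map Complex.re).trace := by
      simp [trace, Complex.re_sum]
    rw [h, hre, trace_sub, Matrix.mul_assoc, trace_mul_comm, Matrix.mul_assoc N,
      trace_mul_comm N, Matrix.mul_assoc, Matrix.mul_assoc, trace_mul_comm K, trace_mul_comm K,
      eq_sub_of_add_eq hPN, Matrix.sub_mul, Matrix.one_mul, trace_sub]
    ring
  have hKH : K.IsHermitian := hK.isHermitian
  refine ⟨hKH.eigenvalues, ?_, fun i => ?_⟩
  · have h1 : E * L * E * (E * L * E)ᵀ = E * (L * L * Eᵀ) := by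
      rw [transpose_mul, transpose_mul, hLT]
      calc E * L * E * (Eᵀ * (L * Eᵀ)) = E * L * (E * Eᵀ) * (L * Eᵀ) := by
            simp only [Matrix.mul_assoc]
        _ = _ := by rw [hEE, Matrix.mul_one]; simp only [Matrix.mul_assoc]
    have h2 : cfc (fun x : ℝ => x ^ 2) K = K * K := by
      rw [cfc_pow_id (R := ℝ) K 2 hKH.isSelfAdjoint, pow_two]
    have h3 := hKH.charpoly_cfc_eq (fun x => x ^ 2)
    rw [h2] at h3
    rw [h1, charpoly_mul_comm, Matrix.mul_assoc, mul_eq_one_comm.1 hEE, Matrix.mul_one, hLK,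
      ← Matrix.map_mul, charpoly_map, h3, Polynomial.map_prod]
    simp
  · set v : Fin 4 → ℝ := (hKH.eigenvectorBasis i).ofLp
    have hv : v ⬝ᵥ v = 1 := by
      have := hKH.eigenvectorBasis.inner_eq_one i
      rwa [EuclideanSpace.inner_eq_star_dotProduct, star_trivial] at this
    have hvK : v ⬝ᵥ K *ᵥ v = hKH.eigenvalues i := by
      rw [hKH.mulVec_eigenvectorBasis i]
      exact (dotProduct_smul _ _ _).trans (by rw [hv, smul_eq_mul, mul_one])
    refine ⟨hK.eigenvalues_nonneg i, eigenvalue_le hP hN hPN hK hf hv hvK, ?_⟩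
    have h := eigenvalue_sub_trace_le hE.posSemidef.map_re hN hPN hK hf hv hvK
    have ht : K.trace = ∑ j, hKH.eigenvalues j := hKH.trace_eq_sum_eigenvalues
    rw [htr, ht]
    linarith

/-- The extension of `Matrix.PosDef.exists_spectrum_mul_transpose` to positive semidefinite `R`: it
holds for `R + ε` with `f + ε`, and a convergent subsequence of the bounded tuples `μ` gives the
limit `ε → 0`. -/
theorem Matrix.PosSemidef.exists_spectrum_mul_transpose {R : Matrix (Fin 4) (Fin 4) ℂ}
    (hR : R.PosSemidef)
    {f : ℝ} (hf : ∀ w : Fin 4 → ℝ, w ⬝ᵥ R.map Complex.re *ᵥ w ≤ f * (w ⬝ᵥ w)) :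
    ∃ μ : Fin 4 → ℝ, (R * Rᵀ).charpoly = ∏ i, (X - C ((μ i ^ 2 : ℝ) : ℂ)) ∧
      ∀ i, 0 ≤ μ i ∧ μ i ≤ f ∧ R.trace.re + 2 * μ i - ∑ j, μ j ≤ 4 * f := by
  let ε : ℕ → ℝ := fun k => 1 / ((k : ℝ) + 1)
  have hε : Filter.Tendsto ε Filter.atTop (nhds 0) := tendsto_one_div_add_atTop_nhds_zero_nat
  have hε0 : ∀ k, 0 < ε k := fun k => by positivity
  have hε1 : ∀ k, ε k ≤ 1 := fun k => by
    rw [div_le_one (by positivity)]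
    exact le_add_of_nonneg_left (Nat.cast_nonneg k)
  let S : ℝ → Matrix (Fin 4) (Fin 4) ℂ := fun t => R + (t : ℂ) • 1
  have hScont : Continuous S := by fun_prop
  have hS0 : S 0 = R := by simp [S]
  have hpos : ∀ k, (S (ε k)).PosDef := fun k =>
    PosDef.posSemidef_add hR (PosDef.one.smul (by simpa using hε0 k))
  have hbound : ∀ k, ∀ w : Fin 4 → ℝ,
      w ⬝ᵥ (S (ε k)).map Complex.re *ᵥ w ≤ (f + ε k) * (w ⬝ᵥ w) := by
    intro k w
    have h : (S (ε k)).map Complex.re = R.map Complex.re + ε k • (1 : Matrix (Fin 4) (Fin 4) ℝ) := by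
      ext i j
      by_cases hij : i = j <;> simp [S, hij]
    rw [h, add_mulVec, smul_mulVec, one_mulVec, dotProduct_add, dotProduct_smul, smul_eq_mul,
      add_mul]
    linarith [hf w]
  choose μ hμ1 hμ2 using fun k => (hpos k).exists_spectrum_mul_transpose (hbound k)
  obtain ⟨ν, -, φ, hφ, hν⟩ := IsCompact.tendsto_subseq
    (isCompact_univ_pi fun _ : Fin 4 => isCompact_Icc (a := (0 : ℝ)) (b := f + 1)) (x := μ)
    fun k i _ => ⟨(hμ2 k i).1, (hμ2 k i).2.1.trans (by linarith [hε1 k])⟩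
  have hεφ : Filter.Tendsto (ε ∘ φ) Filter.atTop (nhds 0) := hε.comp hφ.tendsto_atTop
  have hνi : ∀ i, Filter.Tendsto (fun k => μ (φ k) i) Filter.atTop (nhds (ν i)) :=
    fun i => (tendsto_pi_nhds.1 hν) i
  have hSφ : Filter.Tendsto (fun k => S (ε (φ k))) Filter.atTop (nhds R) := by
    have := (hScont.tendsto 0).comp hεφ
    rwa [hS0] at this
  refine ⟨ν, ?_, fun i => ⟨?_, ?_, ?_⟩⟩
  · refine Polynomial.funext fun z => ?_
    have hl : Filter.Tendsto (fun k => (S (ε (φ k)) * (S (ε (φ k)))ᵀ).charpoly.eval z)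
        Filter.atTop (nhds ((R * Rᵀ).charpoly.eval z)) := by
      simp only [eval_charpoly]
      have hc : Continuous fun A : Matrix (Fin 4) (Fin 4) ℂ => (scalar (Fin 4) z - A * Aᵀ).det := by
        fun_prop
      exact (hc.tendsto R).comp hSφ
    refine tendsto_nhds_unique hl ?_
    simp only [hμ1, eval_prod, eval_sub, eval_X, eval_C]
    refine tendsto_finsetProd _ fun i _ => tendsto_const_nhds.sub ?_
    exact (Complex.continuous_ofReal.tendsto _).comp ((hνi i).pow 2)
  · exact ge_of_tendsto' (hνi i) fun k => (hμ2 (φ k) i).1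
  · refine le_of_tendsto_of_tendsto' (hνi i) ?_ fun k => (hμ2 (φ k) i).2.1
    simpa using hεφ.const_add f
  · refine le_of_tendsto_of_tendsto' (((?_ : Filter.Tendsto _ _ _).add
      ((hνi i).const_mul 2)).sub (tendsto_finsetSum _ fun j _ => hνi j)) ?_
      fun k => (hμ2 (φ k) i).2.2
    · have hc : Continuous fun A : Matrix (Fin 4) (Fin 4) ℂ => A.trace.re := by fun_prop
      exact (hc.tendsto R).comp hSφ
    · simpa using (hεφ.const_add f).const_mul 4

end ComplexCore

/-! ### The magic basis and the lower bound for the fidelity -/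

section LowerBound
open Matrix Polynomial

/-- The matrix whose columns are `√2` times the vectors of the magic basis, the Bell states with
phases for which the spin flip becomes complex conjugation. The factor `√2` keeps the entries in
`{0, ±1, ±i}`. -/
def magicMatrix : Matrix (Fin 2 × Fin 2) (Fin 4) ℂ :=
  of fun p => !![1, Complex.I, 0, 0; 0, 0, Complex.I, 1; 0, 0, Complex.I, -1;
    1, -Complex.I, 0, 0] (finProdFinEquiv p)

theorem magicMatrix_mul_conjTranspose :
    magicMatrix * magicMatrixᴴ = (2 : ℂ) • (1 : TwoQubitOp) := by
  ext ⟨i, j⟩ ⟨k, l⟩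
  fin_cases i <;> fin_cases j <;> fin_cases k <;> fin_cases l <;>
    simp [magicMatrix, mul_apply, Fin.sum_univ_four, finProdFinEquiv, one_apply] <;> norm_num

theorem magicMatrix_mul_transpose :
    magicMatrix * magicMatrixᵀ = (-2 : ℂ) • (pauliY ⊗ₖ pauliY) := by
  ext ⟨i, j⟩ ⟨k, l⟩
  fin_cases i <;> fin_cases j <;> fin_cases k <;> fin_cases l <;>
    simp [magicMatrix, mul_apply, Fin.sum_univ_four, finProdFinEquiv, pauliY] <;> norm_num

theorem map_star_magicMatrix_mul_conjTranspose :
    magicMatrix.map star * magicMatrixᴴ = (-2 : ℂ) • (pauliY ⊗ₖ pauliY) := by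
  have h : magicMatrix.map star * magicMatrixᴴ = (magicMatrix * magicMatrixᵀ).map star := by
    ext i j
    simp [mul_apply]
  rw [h, magicMatrix_mul_transpose]
  ext ⟨i, j⟩ ⟨k, l⟩
  fin_cases i <;> fin_cases j <;> fin_cases k <;> fin_cases l <;>
    simp [pauliY, map_ofNat (starRingEnd ℂ) 2]

/-- The matrix of `ρ` in the magic basis; the scalar `1 / 2` undoes the factors `√2` of
`magicMatrix`. -/
noncomputable def inMagicBasis (ρ : TwoQubitOp) : Matrix (Fin 4) (Fin 4) ℂ :=
  (1 / 2 : ℂ) • (magicMatrixᴴ * ρ * magicMatrix)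

theorem posSemidef_inMagicBasis {ρ : TwoQubitOp} (hρ : ρ.PosSemidef) :
    (inMagicBasis ρ).PosSemidef :=
  (hρ.conjTranspose_mul_mul_same magicMatrix).smul (by rw [Complex.le_def]; norm_num)

theorem trace_inMagicBasis (ρ : TwoQubitOp) : (inMagicBasis ρ).trace = ρ.trace := by
  rw [inMagicBasis, trace_smul, trace_mul_comm, ← Matrix.mul_assoc, magicMatrix_mul_conjTranspose,
    Matrix.smul_mul, Matrix.one_mul, trace_smul, smul_smul]
  norm_num

/-- In the magic basis, the spin flip of a Hermitian `ρ` is its complex conjugate, that is, its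
transpose. -/
theorem charpoly_mul_spinFlip {ρ : TwoQubitOp} (hρ : ρ.IsHermitian) :
    (ρ * spinFlip ρ).charpoly = (inMagicBasis ρ * (inMagicBasis ρ)ᵀ).charpoly := by
  set V := magicMatrix
  have hT : ρ.map star = ρᵀ := by
    conv_rhs => rw [← hρ.eq]
    rfl
  have hY : pauliY ⊗ₖ pauliY = (-1 / 2 : ℂ) • (V * Vᵀ) := by
    rw [magicMatrix_mul_transpose, smul_smul]
    norm_num
  have hY' : pauliY ⊗ₖ pauliY = (-1 / 2 : ℂ) • (V.map star * Vᴴ) := by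
    rw [map_star_magicMatrix_mul_conjTranspose, smul_smul]
    norm_num
  have h1 : ρ * spinFlip ρ = ((1 / 4 : ℂ) • (ρ * (V * Vᵀ) * ρᵀ * V.map star)) * Vᴴ := by
    rw [spinFlip, hT]
    nth_rw 1 [hY]
    rw [hY']
    simp only [Matrix.mul_smul, Matrix.smul_mul, smul_smul, Matrix.mul_assoc]
    norm_num
  have h2 : inMagicBasis ρ * (inMagicBasis ρ)ᵀ =
      Vᴴ * ((1 / 4 : ℂ) • (ρ * (V * Vᵀ) * ρᵀ * V.map star)) := by
    have h : Vᴴᵀ = V.map star := rfl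
    rw [inMagicBasis, transpose_smul, transpose_mul, transpose_mul, h]
    simp only [Matrix.mul_smul, Matrix.smul_mul, smul_smul, Matrix.mul_assoc, V]
    norm_num
  rw [h1, h2, charpoly_mul_comm_of_le _ _ (by simp)]
  simp

/-- Real unit vectors in the magic basis are maximally entangled. -/
theorem isMaximallyEntangled_magicMatrix_mulVec {w : Fin 4 → ℝ} (hw : w ⬝ᵥ w = 1) :
    IsMaximallyEntangled (((√2 : ℝ) : ℂ)⁻¹ • magicMatrix *ᵥ fun i => (w i : ℂ)) := by
  have h2 : ((√2 : ℝ) : ℂ)⁻¹ * ((√2 : ℝ) : ℂ)⁻¹ = 2⁻¹ := by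
    rw [← mul_inv, ← Complex.ofReal_mul, Real.mul_self_sqrt (by norm_num)]
    norm_num
  have hw' : (w 0 : ℂ) * w 0 + w 1 * w 1 + w 2 * w 2 + w 3 * w 3 = 1 := by
    have := congrArg Complex.ofReal hw
    simpa [dotProduct, Fin.sum_univ_four] using this
  unfold IsMaximallyEntangled reducedState
  ext i k
  fin_cases i <;> fin_cases k <;>
    simp [magicMatrix, mulVec, dotProduct, Fin.sum_univ_four, finProdFinEquiv]
  · linear_combination (2 : ℂ)⁻¹ * hw' +
      ((w 0 : ℂ) * w 0 + w 1 * w 1 + w 2 * w 2 + w 3 * w 3) * h2 -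
      (w 1 * w 1 + w 2 * w 2) * ((√2 : ℝ) : ℂ)⁻¹ ^ 2 * Complex.I_sq
  · ring
  · ring
  · linear_combination (2 : ℂ)⁻¹ * hw' +
      ((w 0 : ℂ) * w 0 + w 1 * w 1 + w 2 * w 2 + w 3 * w 3) * h2 -
      (w 1 * w 1 + w 2 * w 2) * ((√2 : ℝ) : ℂ)⁻¹ ^ 2 * Complex.I_sq

/-- The real part of `ρ` in the magic basis is bounded by the fidelity. -/
theorem dotProduct_inMagicBasis_le (ρ : TwoQubitOp) (w : Fin 4 → ℝ) :
    w ⬝ᵥ (inMagicBasis ρ).map Complex.re *ᵥ w ≤ fidelity ρ * (w ⬝ᵥ w) := by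
  have hunit : ∀ u : Fin 4 → ℝ, u ⬝ᵥ u = 1 →
      u ⬝ᵥ (inMagicBasis ρ).map Complex.re *ᵥ u ≤ fidelity ρ := by
    intro u hu
    refine (isGreatest_fidelity ρ).2 ⟨_, isMaximallyEntangled_magicMatrix_mulVec hu, ?_⟩
    have h2 : ((√2 : ℝ) : ℂ)⁻¹ * ((√2 : ℝ) : ℂ)⁻¹ = 1 / 2 := by
      rw [← mul_inv, ← Complex.ofReal_mul, Real.mul_self_sqrt (by norm_num)]
      norm_num
    rw [dotProduct_map_re_mulVec, inMagicBasis, star_smul, mulVec_smul, smul_dotProduct,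
      dotProduct_smul, smul_smul, smul_mulVec, dotProduct_smul, star_mulVec, ← dotProduct_mulVec,
      mulVec_mulVec, mulVec_mulVec, Complex.star_def, map_inv₀, Complex.conj_ofReal, h2,
      Matrix.mul_assoc]
  by_cases hw : w = 0
  · simp [hw]
  have hs : 0 < w ⬝ᵥ w := lt_of_le_of_ne (Finset.sum_nonneg fun j _ => mul_self_nonneg _)
    fun h => hw (dotProduct_self_eq_zero.1 h.symm)
  have h := hunit ((√(w ⬝ᵥ w))⁻¹ • w) (by
    rw [smul_dotProduct, dotProduct_smul, smul_smul, ← mul_inv, Real.mul_self_sqrt hs.le,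
      smul_eq_mul, inv_mul_cancel₀ hs.ne'])
  rw [mulVec_smul, smul_dotProduct, dotProduct_smul, smul_smul, ← mul_inv,
    Real.mul_self_sqrt hs.le, smul_eq_mul, inv_mul_le_iff₀ hs] at h
  linarith

theorem max_le_fidelity {ρ : TwoQubitOp} (hρ : IsTwoQubitState ρ) :
    max ((1 + concurrence ρ) / 4) (concurrence ρ) ≤ fidelity ρ := by
  have hf := dotProduct_inMagicBasis_le ρ
  obtain ⟨μ, hμ, hμf⟩ := (posSemidef_inMagicBasis hρ.1).exists_spectrum_mul_transpose hf
  rw [trace_inMagicBasis, hρ.2, Complex.one_re] at hμf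
  have hroots : ((ρ * spinFlip ρ).charpoly.roots.map fun z => √z.re) =
      Finset.univ.val.map μ := by
    have hprod : (∏ i, (X - C ((μ i ^ 2 : ℝ) : ℂ))) =
        ((Finset.univ.val.map fun i => ((μ i ^ 2 : ℝ) : ℂ)).map fun a => X - C a).prod := by
      rw [Multiset.map_map]
      rfl
    rw [charpoly_mul_spinFlip hρ.1.isHermitian, hμ, hprod, roots_multiset_prod_X_sub_C,
      Multiset.map_map]
    refine Multiset.map_congr rfl fun i _ => ?_
    simp only [Function.comp_apply, Complex.ofReal_re]
    exact Real.sqrt_sq (hμf i).1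
  have hlen := length_woottersList ρ
  have hcoe : (woottersList ρ : Multiset ℝ) = Finset.univ.val.map μ := by
    rw [woottersList, Multiset.sort_eq, hroots]
  have hsum : (woottersList ρ).sum = ∑ j, μ j := by
    rw [← Multiset.sum_coe, hcoe]
    rfl
  have hmem : ∀ x ∈ woottersList ρ, ∃ i, μ i = x := by
    intro x hx
    rw [← Multiset.mem_coe, hcoe] at hx
    obtain ⟨i, -, hi⟩ := Multiset.mem_map.1 hx
    exact ⟨i, hi⟩
  -- The real part has trace one, so one of its four diagonal entries is at least `1 / 4`; this
  -- covers the case of zero concurrence.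
  have hquarter : 1 ≤ 4 * fidelity ρ := by
    have ht : ∑ i, (inMagicBasis ρ i i).re = 1 := by
      have := congrArg Complex.re ((trace_inMagicBasis ρ).trans hρ.2)
      simpa [trace] using this
    have hd : ∀ i, (inMagicBasis ρ i i).re ≤ fidelity ρ := fun i => by
      simpa using hf (Pi.single i 1)
    rw [← ht, Fin.sum_univ_four]
    linarith [hd 0, hd 1, hd 2, hd 3]
  unfold concurrence
  obtain ⟨a, b, c, d, h⟩ : ∃ a b c d, woottersList ρ = [a, b, c, d] := by
    match hw : woottersList ρ, hlen with
    | [a, b, c, d], _ => exact ⟨a, b, c, d, rfl⟩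
  rw [h] at hsum hmem ⊢
  obtain ⟨i, rfl⟩ := hmem a (by simp)
  obtain ⟨j, rfl⟩ := hmem b (by simp)
  obtain ⟨k, rfl⟩ := hmem c (by simp)
  obtain ⟨l, rfl⟩ := hmem d (by simp)
  obtain ⟨hi0, hif, hi⟩ := hμf i
  have hj := (hμf j).1
  have hk := (hμf k).1
  have hl := (hμf l).1
  simp only [List.sum_cons, List.sum_nil] at hsum
  rw [← hsum] at hi
  simp only [List.getD_cons_zero, List.getD_cons_succ]
  rcases max_cases 0 (μ i - μ j - μ k - μ l) with ⟨hc, -⟩ | ⟨hc, -⟩ <;> rw [hc] <;>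
    refine max_le ?_ ?_ <;> linarith

end LowerBound

/-! ### The minimizing states -/

section Examples
open Matrix Polynomial

/-- The common shape of `lowState` and `highState`. Under `p * q = c ^ 2 / 4` the middle block has
rank at most one. -/
noncomputable def blockState (a p q c : ℝ) : TwoQubitOp :=
  ofProductBasis !![a, 0, 0, 0; 0, p, -c / 2, 0; 0, -c / 2, q, 0; 0, 0, 0, 0]

/-- A factor `B` of `blockState a p q c = B * Bᴴ`, with one column for `|00⟩` and one for the middle
block; the columns are orthogonal. -/
noncomputable def blockFactor (a p q : ℝ) : Matrix (Fin 2 × Fin 2) (Fin 2) ℂ :=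
  of fun i => (!![√a, 0; 0, √p; 0, -√q; 0, 0] : Matrix (Fin 4) (Fin 2) ℝ).map Complex.ofReal
    (finProdFinEquiv i)

variable {a p q c : ℝ}

theorem blockState_eq_mul (ha : 0 ≤ a) (hp : 0 ≤ p) (hq : 0 ≤ q) (hc : 0 ≤ c)
    (hpq : p * q = c ^ 2 / 4) :
    blockState a p q c = blockFactor a p q * (blockFactor a p q)ᴴ := by
  have h : √p * √q = c / 2 := by
    rw [← Real.sqrt_mul hp, hpq, show c ^ 2 / 4 = (c / 2) ^ 2 by ring, Real.sqrt_sq (by positivity)]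
  have h' : (√p : ℂ) * √q = c / 2 := by exact_mod_cast h
  have ha' : (√a : ℂ) * √a = a := by exact_mod_cast Real.mul_self_sqrt ha
  have hp' : (√p : ℂ) * √p = p := by exact_mod_cast Real.mul_self_sqrt hp
  have hq' : (√q : ℂ) * √q = q := by exact_mod_cast Real.mul_self_sqrt hq
  ext ⟨i, j⟩ ⟨k, l⟩
  fin_cases i <;> fin_cases j <;> fin_cases k <;> fin_cases l <;>
    simp [blockState, ofProductBasis, blockFactor, mul_apply, finProdFinEquiv, ha', hp', hq', h',
      mul_comm (√q : ℂ) √p, neg_div]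

theorem conjTranspose_mul_blockFactor (ha : 0 ≤ a) (hp : 0 ≤ p) (hq : 0 ≤ q) :
    (blockFactor a p q)ᴴ * blockFactor a p q = diagonal ![(a : ℂ), p + q] := by
  have ha' : (√a : ℂ) * √a = a := by exact_mod_cast Real.mul_self_sqrt ha
  have hp' : (√p : ℂ) * √p = p := by exact_mod_cast Real.mul_self_sqrt hp
  have hq' : (√q : ℂ) * √q = q := by exact_mod_cast Real.mul_self_sqrt hq
  ext i j
  fin_cases i <;> fin_cases j <;>
    simp [blockFactor, mul_apply, Fintype.sum_prod_type, finProdFinEquiv, ha', hp', hq']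

theorem isTwoQubitState_blockState (ha : 0 ≤ a) (hp : 0 ≤ p) (hq : 0 ≤ q) (hc : 0 ≤ c)
    (hpq : p * q = c ^ 2 / 4) (h1 : a + p + q = 1) : IsTwoQubitState (blockState a p q c) := by
  refine ⟨?_, ?_⟩
  · rw [blockState_eq_mul ha hp hq hc hpq]
    exact posSemidef_self_mul_conjTranspose _
  · have h : (a : ℂ) + p + q = 1 := by exact_mod_cast h1
    simpa [blockState, ofProductBasis, trace, Fintype.sum_prod_type, finProdFinEquiv, add_assoc]
      using h

theorem rank_blockState (ha : 0 ≤ a) (hp : 0 ≤ p) (hq : 0 ≤ q) (hc : 0 ≤ c)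
    (hpq : p * q = c ^ 2 / 4) :
    (blockState a p q c).rank = (diagonal ![(a : ℂ), p + q]).rank := by
  rw [blockState_eq_mul ha hp hq hc hpq, rank_self_mul_conjTranspose,
    ← rank_conjTranspose_mul_self, conjTranspose_mul_blockFactor ha hp hq]

theorem rank_blockState_of_pos (ha : 0 < a) (hp : 0 ≤ p) (hq : 0 ≤ q) (hc : 0 ≤ c)
    (hpq : p * q = c ^ 2 / 4) (hs : 0 < p + q) : (blockState a p q c).rank = 2 := by
  have hs' : (p : ℂ) + q ≠ 0 := by exact_mod_cast hs.ne'
  have hd : IsUnit (diagonal ![(a : ℂ), p + q]) := by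
    rw [isUnit_iff_isUnit_det, det_diagonal]
    simp [hs', ha.ne']
  rw [rank_blockState ha.le hp hq hc hpq, rank_of_isUnit _ hd, Fintype.card_fin]

theorem rank_blockState_zero (hp : 0 ≤ p) (hq : 0 ≤ q) (hc : 0 ≤ c)
    (hpq : p * q = c ^ 2 / 4) (hs : 0 < p + q) : (blockState 0 p q c).rank = 1 := by
  have hs' : (p : ℂ) + q ≠ 0 := by exact_mod_cast hs.ne'
  rw [rank_blockState le_rfl hp hq hc hpq, rank_diagonal, Fintype.card_eq_one_iff]
  refine ⟨⟨1, by simpa using hs'⟩, ?_⟩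
  rintro ⟨i, hi⟩
  fin_cases i
  · simp at hi
  · rfl

theorem charpoly_blockState_mul_spinFlip (hpq : p * q = c ^ 2 / 4) :
    (blockState a p q c * spinFlip (blockState a p q c)).charpoly =
      X ^ 3 * (X - C ((c ^ 2 : ℝ) : ℂ)) := by
  have hpq' : (p : ℂ) * q = c ^ 2 / 4 := by exact_mod_cast hpq
  have h : blockState a p q c * spinFlip (blockState a p q c) =
      reindex finProdFinEquiv.symm finProdFinEquiv.symm
        (!![0, 0, 0, 0; 0, c ^ 2 / 2, -(p * c), 0; 0, -(q * c), c ^ 2 / 2, 0;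
          0, 0, 0, 0] : Matrix (Fin 4) (Fin 4) ℂ) := by
    ext ⟨i, j⟩ ⟨k, l⟩
    fin_cases i <;> fin_cases j <;> fin_cases k <;> fin_cases l <;>
      simp [blockState, ofProductBasis, spinFlip, pauliY, mul_apply, Fintype.sum_prod_type,
        finProdFinEquiv]
    · linear_combination hpq'
    · ring
    · ring
    · linear_combination hpq'
  refine Polynomial.funext fun z => ?_
  rw [h, charpoly_reindex, eval_charpoly]
  simp [det_succ_row_zero, Fin.sum_univ_succ, Fin.succAbove]
  linear_combination (-z ^ 2 * c ^ 2) * hpq'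

theorem concurrence_blockState (hc : 0 ≤ c) (hpq : p * q = c ^ 2 / 4) :
    concurrence (blockState a p q c) = c := by
  have hroots : (X ^ 3 * (X - C ((c ^ 2 : ℝ) : ℂ))).roots = {0, 0, 0, ((c ^ 2 : ℝ) : ℂ)} := by
    rw [roots_mul (mul_ne_zero (pow_ne_zero _ X_ne_zero) (X_sub_C_ne_zero _)), roots_X_pow,
      roots_X_sub_C]
    rfl
  have hl : woottersList (blockState a p q c) = [c, 0, 0, 0] := by
    have hm : (({0, 0, 0, ((c ^ 2 : ℝ) : ℂ)} : Multiset ℂ).map fun z => √z.re) =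
        ([c, 0, 0, 0] : List ℝ) := by
      simp only [Multiset.insert_eq_cons, Multiset.map_cons, Multiset.map_singleton,
        Complex.zero_re, Real.sqrt_zero, Complex.ofReal_re, Real.sqrt_sq hc]
      exact Multiset.coe_eq_coe.2 (List.perm_append_comm (l₁ := [0, 0, 0]) (l₂ := [c]))
    rw [woottersList, charpoly_blockState_mul_spinFlip hpq, hroots, hm, Multiset.coe_sort]
    refine List.mergeSort_eq_self _ ?_
    simp [hc]
  rw [concurrence, hl]
  simp [hc]

/-- A maximally entangled `ψ` has `|ψ₀₀|² + |ψ₀₁|² = 1 / 2` and `|ψ₁₀| = |ψ₀₁|`, so its overlap with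
the state is at most `a |ψ₀₀|² + (p + q + c) |ψ₀₁|²`. -/
theorem fidelity_blockState_le {f : ℝ} (hc : 0 ≤ c) (ha : a / 2 ≤ f) (hf : (p + q + c) / 2 ≤ f) :
    fidelity (blockState a p q c) ≤ f := by
  obtain ⟨ψ, hψ, hx⟩ := (isGreatest_fidelity (blockState a p q c)).1
  have e00 := congrFun (congrFun hψ 0) 0
  have e11 := congrFun (congrFun hψ 1) 1
  have e01 := congrFun (congrFun hψ 0) 1
  simp [reducedState, Complex.mul_conj] at e00 e11 e01
  have n0 : Complex.normSq (ψ (0, 0)) + Complex.normSq (ψ (0, 1)) = 1 / 2 := by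
    have := congrArg Complex.re e00
    simpa using this
  have n1 : Complex.normSq (ψ (1, 0)) + Complex.normSq (ψ (1, 1)) = 1 / 2 := by
    have := congrArg Complex.re e11
    simpa using this
  have n2 : Complex.normSq (ψ (0, 0)) * Complex.normSq (ψ (1, 0)) =
      Complex.normSq (ψ (0, 1)) * Complex.normSq (ψ (1, 1)) := by
    have := congrArg Complex.normSq (eq_neg_of_add_eq_zero_left e01)
    simpa using this
  have n3 : Complex.normSq (ψ (1, 0)) = Complex.normSq (ψ (0, 1)) := by
    linear_combination 2 * n2 - 2 * Complex.normSq (ψ (1, 0)) * n0 +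
      2 * Complex.normSq (ψ (0, 1)) * n1
  have hval : (star ψ ⬝ᵥ (blockState a p q c *ᵥ ψ)).re = a * Complex.normSq (ψ (0, 0)) +
      p * Complex.normSq (ψ (0, 1)) + q * Complex.normSq (ψ (1, 0)) -
      c * ((ψ (0, 1)).re * (ψ (1, 0)).re + (ψ (0, 1)).im * (ψ (1, 0)).im) := by
    simp [blockState, ofProductBasis, dotProduct, mulVec, Fintype.sum_prod_type, finProdFinEquiv,
      Complex.normSq_apply]
    ring
  have hcross : -((ψ (0, 1)).re * (ψ (1, 0)).re + (ψ (0, 1)).im * (ψ (1, 0)).im) ≤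
      Complex.normSq (ψ (0, 1)) := by
    have h := n3
    rw [Complex.normSq_apply, Complex.normSq_apply] at h
    rw [Complex.normSq_apply]
    nlinarith [sq_nonneg ((ψ (0, 1)).re + (ψ (1, 0)).re),
      sq_nonneg ((ψ (0, 1)).im + (ψ (1, 0)).im)]
  rw [hx, hval, n3]
  have hfn := congrArg (f * ·) n0
  nlinarith [mul_le_mul_of_nonneg_left hcross hc,
    mul_le_mul_of_nonneg_right ha (Complex.normSq_nonneg (ψ (0, 0))),
    mul_le_mul_of_nonneg_right hf (Complex.normSq_nonneg (ψ (0, 1)))]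

theorem lowState_eq_blockState (c : ℝ) : lowState c = blockState ((1 + c) / 2)
    ((1 - c + √(1 - 2 * c - 3 * c ^ 2)) / 4) ((1 - c - √(1 - 2 * c - 3 * c ^ 2)) / 4) c := rfl

theorem highState_eq_blockState (c : ℝ) :
    highState c = blockState (1 - c) (c / 2) (c / 2) c := rfl

theorem lowState_minimizes {c : ℝ} (hc : 0 ≤ c) (hc3 : c ≤ 1 / 3) :
    IsTwoQubitState (lowState c) ∧ (lowState c).rank = 2 ∧
      concurrence (lowState c) = c ∧ fidelity (lowState c) = max ((1 + c) / 4) c := by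
  rw [lowState_eq_blockState]
  set s := √(1 - 2 * c - 3 * c ^ 2) with hs
  have hs0 : 0 ≤ s := Real.sqrt_nonneg _
  have hss : s ^ 2 = 1 - 2 * c - 3 * c ^ 2 :=
    Real.sq_sqrt (by nlinarith : 0 ≤ 1 - 2 * c - 3 * c ^ 2)
  have hs1 : s ≤ 1 - c := abs_le_of_sq_le_sq' (by nlinarith) (by linarith) |>.2
  have ha : 0 < (1 + c) / 2 := by linarith
  have hp : 0 ≤ (1 - c + s) / 4 := by linarith
  have hq : 0 ≤ (1 - c - s) / 4 := by linarith
  have hpq : (1 - c + s) / 4 * ((1 - c - s) / 4) = c ^ 2 / 4 := by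
    linear_combination (-1 / 16) * hss
  have hstate := isTwoQubitState_blockState ha.le hp hq hc hpq (by ring)
  have hconc := concurrence_blockState (a := (1 + c) / 2) hc hpq
  refine ⟨hstate, rank_blockState_of_pos ha hp hq hc hpq (by linarith), hconc,
    le_antisymm ?_ ?_⟩
  · refine fidelity_blockState_le hc ?_ ?_ <;> refine le_max_of_le_left ?_ <;> linarith
  · simpa only [hconc] using max_le_fidelity hstate

theorem highState_minimizes {c : ℝ} (hc3 : 1 / 3 ≤ c) (hc1 : c ≤ 1) :
    IsTwoQubitState (highState c) ∧ (c < 1 → (highState c).rank = 2) ∧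
      (c = 1 → (highState c).rank = 1) ∧
      concurrence (highState c) = c ∧ fidelity (highState c) = max ((1 + c) / 4) c := by
  rw [highState_eq_blockState]
  have hc : 0 ≤ c := by linarith
  have hp : 0 ≤ c / 2 := by linarith
  have hpq : c / 2 * (c / 2) = c ^ 2 / 4 := by ring
  have hstate := isTwoQubitState_blockState (a := 1 - c) (by linarith) hp hp hc hpq (by ring)
  have hconc := concurrence_blockState (a := 1 - c) hc hpq
  refine ⟨hstate, fun h => rank_blockState_of_pos (by linarith) hp hp hc hpq (by linarith),
    fun h => ?_, hconc, le_antisymm ?_ ?_⟩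
  · rw [h, sub_self]
    exact rank_blockState_zero (by norm_num) (by norm_num) (by norm_num) (by norm_num)
      (by norm_num)
  · refine fidelity_blockState_le hc ?_ ?_ <;> refine le_max_of_le_right ?_ <;> linarith
  · simpa only [hconc] using max_le_fidelity hstate

end Examples

theorem theorem2 :
    (∀ ρ : TwoQubitOp, IsTwoQubitState ρ →
      max ((1 + concurrence ρ) / 4) (concurrence ρ) ≤ fidelity ρ) ∧
    (∀ c : ℝ, 0 ≤ c → c ≤ 1 →
      IsLeast {f : ℝ | ∃ ρ : TwoQubitOp, IsTwoQubitState ρ ∧ concurrence ρ = c ∧ fidelity ρ = f}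
        (max ((1 + c) / 4) c)) ∧
    (∀ c : ℝ, 0 ≤ c → c ≤ 1 / 3 →
      IsTwoQubitState (lowState c) ∧ (lowState c).rank = 2 ∧
      concurrence (lowState c) = c ∧ fidelity (lowState c) = max ((1 + c) / 4) c) ∧
    (∀ c : ℝ, 1 / 3 ≤ c → c ≤ 1 →
      IsTwoQubitState (highState c) ∧ (c < 1 → (highState c).rank = 2) ∧
      (c = 1 → (highState c).rank = 1) ∧
      concurrence (highState c) = c ∧ fidelity (highState c) = max ((1 + c) / 4) c) := by
  refine ⟨fun ρ hρ => max_le_fidelity hρ, fun c hc hc1 => ⟨?_, ?_⟩,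
    fun c hc hc3 => lowState_minimizes hc hc3, fun c hc3 hc1 => highState_minimizes hc3 hc1⟩
  · rcases le_total c (1 / 3) with h | h
    · obtain ⟨h1, -, h2, h3⟩ := lowState_minimizes hc h
      exact ⟨_, h1, h2, h3⟩
    · obtain ⟨h1, -, -, h2, h3⟩ := highState_minimizes h hc1
      exact ⟨_, h1, h2, h3⟩
  · rintro f ⟨ρ, hρ, rfl, rfl⟩
    exact max_le_fidelity hρ
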